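/- Let $k\ge 0$ and $n\ge 2$ be integers, and consider words over a fixed $k$-letter alphabet. The Hamming distance of two words of equal length is the number of positions in which they differ. A word $v$ is a conjugate of a word $u$ if $u=xy$ and $v=yx$ for some non-empty words $x,y$. A word is a power if it equals $z^r$ for some word $z$ and some integer $r\ge 2$. Let $h(n)$ be the number of length-$n$ words that have a conjugate at Hamming distance exactly $2$. For $1\le i<n$ let $H(n,i)$ be the set of length-$n$ words $u$ at Hamming distance exactly $2$ from the cyclic left shift of $u$ by $i$ positions. Let $h''(n,i)$ be the number of words in $H(n,i)$ that lie in no $H(n,j)$ with $1\le j<i$. Let $p_k(m)$ be the number of length-$m$ words that are powers. Then \[ h(n)=\sum_{i=1}^{\lfloor n/2\rfloor} h''(n,i), \] where for every $1\le i\le\lfloor n/2\rfloor$ \[ h''(n,i)=\begin{cases}\frac12\, n(k-1)\Big(k^{\gcd(n,i)}\big(\frac{n}{\gcd(n,i)}-1\big)-2p_k(i)\Big), & \text{if } i\mid n,\\[2pt] \frac12\, k^{\gcd(n,i)}(k-1)\,n\big(\frac{n}{\gcd(n,i)}-3\big), & \text{otherwise,}\end{cases} \] and for every integer $m\ge 1$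 \[ p_k(m)=k^m-\sum_{d\mid m}\mu(d)\,k^{m/d}, \] where $\mu$ is the Möbius function. -/

import Mathlib

namespace AlmostCommute

/-- The Hamming distance of two words of equal length: the number of positions where they
differ. It is only applied to words of equal length. -/
def ham {α : Type*} [DecidableEq α] (u v : List α) : ℕ :=
  ((Finset.range u.length).filter fun p => u[p]? ≠ v[p]?).card

/-- `v` is a conjugate of `u`: there are non-empty words `x`, `y` with `u = xy` and `v = yx`. -/
def Conjugate {α : Type*} (u v : List α) : Prop :=
  ∃ x y : List α, x ≠ [] ∧ y ≠ [] ∧ u = x ++ y ∧ v = y ++ x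

/-- `w` is a power: `w = z ^ i` for some word `z` and some `i ≥ 2`. -/
def IsPower {α : Type*} (w : List α) : Prop :=
  ∃ (z : List α) (i : ℕ), 2 ≤ i ∧ w = (List.replicate i z).flatten

/-- `H(n)`: the length-`n` words over a `k`-letter alphabet that have a conjugate at Hamming
distance exactly `2`. -/
def conjSet (k n : ℕ) : Set (List (Fin k)) :=
  {u | u.length = n ∧ ∃ v, Conjugate u v ∧ ham u v = 2}

/-- `h(n) = |H(n)|`. -/
noncomputable def conjCount (k n : ℕ) : ℕ := (conjSet k n).ncard

/-- `H(n, i)` for `1 ≤ i < n`: the length-`n` words `u` over a `k`-letter alphabet whose cyclic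
left shift by `i` positions is at Hamming distance exactly `2` from `u`. -/
def shiftSet (k n i : ℕ) : Set (List (Fin k)) :=
  {u | u.length = n ∧ ham u (u.rotate i) = 2}

/-- The words of `H(n, i)` that lie in no `H(n, j)` with `1 ≤ j < i`. -/
def firstShiftSet (k n i : ℕ) : Set (List (Fin k)) :=
  {u | u ∈ shiftSet k n i ∧ ∀ j, 1 ≤ j → j < i → u ∉ shiftSet k n j}

/-- The number of words of `H(n, i)` that lie in no `H(n, j)` with `1 ≤ j < i`. -/
noncomputable def firstShiftCount (k n i : ℕ) : ℕ := (firstShiftSet k n i).ncard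

/-- `p_k(m)`: the number of length-`m` words over a `k`-letter alphabet that are powers. -/
noncomputable def powerCount (k m : ℕ) : ℕ :=
  {w : List (Fin k) | w.length = m ∧ IsPower w}.ncard

end AlmostCommute

/-! Read a word as `f : ZMod n → A`; its distance to the shift by `i` is the number of jumps, the
`x` with `f x ≠ f (x + i)`. Let g = gcd(n, i). Translation by `i` splits the positions into cycles
of length n/g, and no cycle carries exactly one jump. So if there are two jumps they share a cycle,
and `f` is a g-periodic word with one letter written along an arc of that cycle. Counting pairs
(word, jump) gives 2|H(n,i)| = k^g n (n/g - 1)(k - 1): `two_mul_card_changes_eq_two`.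

From H(n,i) one removes the words lying in some H(n,j) with j < i. Embed the alphabet in ℤ: the
differences of `f` along `i` and along `j` each have one positive and one opposite negative value.
The two difference operators commute, which forces `f` to be a one-letter change of a word having
both periods (`exists_periodic_of_card_changes`). For i ≤ n/2 the removed words are therefore the
one-letter changes of words with a period d < i dividing g (`repeatShift_iff`), and the underlying
word is unique (`eq_of_update_eq`). This removes E n (k - 1) words, where E = k^g if i ∤ n and E =
p_k(i) if i ∣ n.

Opposite shifts have equal distance, so the least shift is at most n/2. Möbius inversion over
minimal periods gives p_k. -/

namespace AlmostCommute
open Function Finset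

/-! ### Words at distance two from two different translates -/

section Key
variable {G : Type*} [AddCommGroup G]

/-- The positions at which `f` differs from its translate by `c`. -/
def changes [Fintype G] {A : Type*} [DecidableEq A] (f : G → A) (c : G) : Finset G :=
  univ.filter fun x => f x ≠ f (x + c)

theorem mem_changes [Fintype G] {A : Type*} [DecidableEq A] {f : G → A} {c x : G} :
    x ∈ changes f c ↔ f x ≠ f (x + c) := by simp [changes]

/-- The differences sum to zero over `G`, so the two nonzero ones are opposite. Taking `e` positive
tells `p` from `q`, on which later sign comparisons rely. -/
theorem exists_diff_eq_of_card_changes [Fintype G] [DecidableEq G] {F : G → ℤ} {c : G}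
    (h : (changes F c).card = 2) : ∃ p q : G, ∃ e : ℤ, p ≠ q ∧ 0 < e ∧
      ∀ x, F (x + c) - F x = (if x = p then e else 0) - (if x = q then e else 0) := by
  obtain ⟨p, q, hpq, hs⟩ := card_eq_two.1 h
  have hout : ∀ x, x ≠ p → x ≠ q → F (x + c) - F x = 0 := by
    intro x hp hq
    have : x ∉ changes F c := by rw [hs]; simp [hp, hq]
    rw [mem_changes, not_not] at this
    rw [this, sub_self]
  have hp : F (p + c) - F p ≠ 0 := by
    have : p ∈ changes F c := by rw [hs]; simp
    rw [mem_changes] at this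
    exact sub_ne_zero.2 (Ne.symm this)
  have hsum : ∑ x, (F (x + c) - F x) = 0 := by
    rw [sum_sub_distrib, sub_eq_zero]
    exact Fintype.sum_equiv (Equiv.addRight c) _ _ fun x => rfl
  have hsum2 : (F (p + c) - F p) + (F (q + c) - F q) = 0 := by
    rw [← hsum, ← sum_pair hpq (f := fun x => F (x + c) - F x)]
    refine sum_subset (subset_univ _) fun x _ hx => ?_
    simp only [mem_insert, mem_singleton, not_or] at hx
    exact hout x hx.1 hx.2
  rcases lt_or_gt_of_ne hp with hlt | hgt
  · refine ⟨q, p, F (q + c) - F q, hpq.symm, by linarith, fun x => ?_⟩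
    by_cases h1 : x = p
    · subst h1; simp [hpq]; linarith
    · by_cases h2 : x = q
      · subst h2; simp [h1]
      · simp [h1, h2, hout x h1 h2]
  · refine ⟨p, q, F (p + c) - F p, hpq, by linarith, fun x => ?_⟩
    by_cases h1 : x = p
    · subst h1; simp [hpq]
    · by_cases h2 : x = q
      · subst h2; simp [h1]; linarith
      · simp [h1, h2, hout x h1 h2]

/-- The letter at `p` is isolated: `p - c` and `p + c` both carry `y`, so writing `y` at `p` repairs
both jumps. -/
theorem periodic_update_of_diff [DecidableEq G] {A : Type*} {F : A → ℤ} (hF : Injective F)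
    {f : G → A} {c p : G} (hc : c ≠ 0) {e : ℤ} {y : A} (hy : F y = F (f p) + e)
    (hd : ∀ x, F (f (x + c)) - F (f x) = (if x = p then e else 0) - (if x = p - c then e else 0)) :
    Periodic (update f p y) c := by
  intro x
  by_cases h1 : x = p
  · subst h1
    have h := hd x
    have h2 : x ≠ x - c := by simpa [eq_sub_iff_add_eq] using hc
    simp only [if_true, if_neg h2, sub_zero] at h
    rw [update_of_ne (by simpa using hc), update_self]
    exact hF (by linarith)
  · by_cases h2 : x = p - c
    · have h := hd x
      rw [if_neg h1, if_pos h2] at h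
      have h3 : x + c = p := by rw [h2]; abel
      rw [h3] at h ⊢
      rw [update_self, update_of_ne h1]
      exact hF (by linarith)
    · have h3 : x + c ≠ p := fun h => h2 (eq_sub_of_add_eq h)
      have h := hd x
      rw [if_neg h1, if_neg h2] at h
      rw [update_of_ne h1, update_of_ne h3]
      exact hF (by linarith)

theorem exists_periodic_of_card_changes [Fintype G] [DecidableEq G] {A : Type*} [DecidableEq A] {F : A → ℤ}
    (hF : Injective F) {f : G → A} {c d : G} (hc : c ≠ 0) (hd : d ≠ 0) (hcd : c ≠ d) (hadd : c + d ≠ 0)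
    (h1 : (changes f c).card = 2) (h2 : (changes f d).card = 2) :
    ∃ (v : G → A) (x : G) (b : A), Periodic v c ∧ Periodic v d ∧ b ≠ v x ∧ f = update v x b := by
  have hch : ∀ a, changes (F ∘ f) a = changes f a := fun a => by
    ext x; simp [mem_changes, hF.eq_iff]
  obtain ⟨p, q, e, hpq, he, hp⟩ := exists_diff_eq_of_card_changes (F := F ∘ f) (by rw [hch, h1])
  obtain ⟨r, s, e', hrs, he', hr⟩ := exists_diff_eq_of_card_changes (F := F ∘ f) (by rw [hch, h2])
  simp only [comp_apply] at hp hr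
  -- The mixed second difference of `F ∘ f`, computed in both orders.
  have key : ∀ x, ((if x + d = p then e else 0) - (if x + d = q then e else 0))
      - ((if x = p then e else 0) - (if x = q then e else 0))
      = ((if x + c = r then e' else 0) - (if x + c = s then e' else 0))
      - ((if x = r then e' else 0) - (if x = s then e' else 0)) := by
    intro x
    rw [← hp, ← hp, ← hr, ← hr, add_right_comm x d c]
    ring
  have concl : ∀ (z : G) (a : ℤ), a ≠ 0 →
      (∀ x, F (f (x + c)) - F (f x) = (if x = z then a else 0) - (if x = z - c then a else 0)) →
      (∀ x, F (f (x + d)) - F (f x) = (if x = z then a else 0) - (if x = z - d then a else 0)) →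
      ∃ (v : G → A) (x : G) (b : A), Periodic v c ∧ Periodic v d ∧ b ≠ v x ∧
        f = update v x b := by
    intro z a ha hzc hzd
    have hy : F (f (z + c)) = F (f z) + a := by
      have h := hzc z
      have h2 : z ≠ z - c := by simpa [eq_sub_iff_add_eq] using hc
      simp only [if_true, if_neg h2, sub_zero] at h
      linarith
    refine ⟨update f z (f (z + c)), z, f z, periodic_update_of_diff hF hc hy hzc,
      periodic_update_of_diff hF hd hy hzd, ?_, by simp⟩
    rw [update_self]
    intro h
    rw [← h] at hy
    omega
  -- At `x = r` the right side is at most `-e' < 0`, so a negative term on the left must be active.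
  have h_r : r = p ∨ r + d = q := by
    have := key r
    grind
  rcases h_r with rfl | h_r
  · have hq : q = r - c := by
      have := key (r - c)
      grind
    have hs : s = r - d := by
      have := key (r - d)
      grind
    have hee : e = e' := by
      have := key r
      grind
    subst hq hs hee
    exact concl r e he.ne' hp hr
  · have hr' : r = q - d := eq_sub_of_add_eq h_r
    have hp' : p = q - c := by
      have := key (r - c)
      grind
    have hs : s = q := by
      have := key q
      grind
    subst hr' hp' hs
    have hee : e = e' := by
      have := key s
      grind
    subst hee
    -- Here the isolated letter sits at the common negative end, hence the sign.
    refine concl s (-e) (by omega) (fun x => ?_) (fun x => ?_)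
    · rw [hp]; split_ifs <;> ring
    · rw [hr]; split_ifs <;> ring

theorem changes_update [Fintype G] [DecidableEq G] {A : Type*} [DecidableEq A]
    {v : G → A} {c x : G} {b : A} (hc : c ≠ 0) (hv : Periodic v c) (hb : b ≠ v x) :
    changes (update v x b) c = {x, x - c} := by
  ext y
  rw [mem_changes, mem_insert, mem_singleton]
  by_cases h1 : y = x
  · subst h1
    rw [update_self, update_of_ne (by simpa using hc), hv]
    simp [hb]
  · by_cases h2 : y = x - c
    · have h3 : y + c = x := by rw [h2]; abel
      rw [h3, update_self, update_of_ne h1]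
      simp only [h2, or_true, iff_true]
      rw [← hv, sub_add_cancel]
      exact hb.symm
    · have h3 : y + c ≠ x := fun h => h2 (eq_sub_of_add_eq h)
      rw [update_of_ne h1, update_of_ne h3, hv]
      simp [h1, h2]

theorem card_changes_update [Fintype G] [DecidableEq G] {A : Type*} [DecidableEq A]
    {v : G → A} {c x : G} {b : A} (hc : c ≠ 0) (hv : Periodic v c) (hb : b ≠ v x) :
    (changes (update v x b) c).card = 2 := by
  rw [changes_update hc hv hb, card_pair]
  simpa [eq_sub_iff_add_eq] using hc

theorem card_changes_neg [Fintype G] {A : Type*} [DecidableEq A] (f : G → A) (c : G) :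
    (changes f (-c)).card = (changes f c).card := by
  refine card_bij' (fun x _ => x - c) (fun x _ => x + c) ?_ ?_ ?_ ?_ <;> intro x <;>
    simp [mem_changes, sub_eq_add_neg, ne_comm]

end Key

/-! ### Counting words with exactly two jumps along one translation -/

section Arc
variable {G : Type*} [AddCommGroup G]

/-- `x` is one of `p + c, p + 2c, …, p + tc`. -/
def InArc (c p : G) (t : ℕ) (x : G) : Prop := ∃ s, 1 ≤ s ∧ s ≤ t ∧ x = p + s • c

open Classical in
/-- The word `v` with the letters on an arc replaced by `b`. -/
noncomputable def arcFill {A : Type*} (c : G) (v : G → A) (p : G) (t : ℕ) (b : A) : G → A :=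
  fun x => if InArc c p t x then b else v x

theorem nsmul_ne_of_lt_addOrderOf {c p : G} {s t : ℕ} (hs : s < addOrderOf c)
    (ht : t < addOrderOf c) (h : p + s • c = p + t • c) : s = t :=
  nsmul_injOn_Iio_addOrderOf hs ht (add_left_cancel h)

theorem not_inArc_self {c p : G} {t : ℕ} (ht : t < addOrderOf c) : ¬ InArc c p t p := by
  rintro ⟨s, h1, h2, h⟩
  have : 0 = s := nsmul_ne_of_lt_addOrderOf (c := c) (p := p) (by omega) (by omega) (by simpa using h)
  omega

theorem inArc_add_self {c p : G} {t : ℕ} (ht : 1 ≤ t) : InArc c p t (p + c) :=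
  ⟨1, le_rfl, ht, by simp⟩

theorem inArc_end {c p : G} {t : ℕ} (ht : 1 ≤ t) : InArc c p t (p + t • c) :=
  ⟨t, ht, le_rfl, rfl⟩

theorem not_inArc_end_add {c p : G} {t : ℕ} (ht : t < addOrderOf c) :
    ¬ InArc c p t (p + t • c + c) := by
  rintro ⟨s, h1, h2, h⟩
  obtain ⟨s, rfl⟩ : ∃ u, s = u + 1 := ⟨s - 1, by omega⟩
  rw [add_assoc, ← succ_nsmul] at h
  have h' : p + t • c = p + s • c := by
    rw [succ_nsmul, succ_nsmul, ← add_assoc, ← add_assoc] at h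
    exact add_right_cancel h
  have := nsmul_ne_of_lt_addOrderOf ht (by omega) h'
  omega

theorem eq_of_inArc_add {c p : G} {t : ℕ} {x : G} (h1 : ¬ InArc c p t x)
    (h2 : InArc c p t (x + c)) : x = p := by
  obtain ⟨s, hs1, hs2, h⟩ := h2
  obtain ⟨s, rfl⟩ : ∃ u, s = u + 1 := ⟨s - 1, by omega⟩
  rw [succ_nsmul, ← add_assoc] at h
  have hx := add_right_cancel h
  rcases Nat.eq_zero_or_pos s with rfl | hs
  · simpa using hx
  · exact absurd ⟨s, hs, by omega, hx⟩ h1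

theorem eq_of_not_inArc_add {c p : G} {t : ℕ} {x : G} (h1 : InArc c p t x)
    (h2 : ¬ InArc c p t (x + c)) : x = p + t • c := by
  obtain ⟨s, hs1, hs2, rfl⟩ := h1
  rcases hs2.eq_or_lt with rfl | hlt
  · rfl
  · exact absurd ⟨s + 1, by omega, hlt, by rw [succ_nsmul, add_assoc]⟩ h2

theorem arcFill_of_inArc {A : Type*} {c p x : G} {v : G → A} {t : ℕ} {b : A}
    (h : InArc c p t x) : arcFill c v p t b x = b := if_pos h

theorem arcFill_of_not_inArc {A : Type*} {c p x : G} {v : G → A} {t : ℕ} {b : A}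
    (h : ¬ InArc c p t x) : arcFill c v p t b x = v x := if_neg h

variable [Fintype G] [DecidableEq G] {A : Type*} [DecidableEq A]

theorem changes_arcFill {c p : G} {v : G → A} {t : ℕ} {b : A} (hv : Periodic v c) (h1 : 1 ≤ t)
    (ht : t < addOrderOf c) (hb : b ≠ v p) :
    changes (arcFill c v p t b) c = {p, p + t • c} := by
  have hvt : v (p + t • c) = v p := hv.nsmul t p
  ext x
  rw [mem_changes, mem_insert, mem_singleton]
  constructor
  · intro h
    by_cases ha : InArc c p t x <;> by_cases hb : InArc c p t (x + c)
    · exact absurd (by rw [arcFill_of_inArc ha, arcFill_of_inArc hb]) h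
    · exact Or.inr (eq_of_not_inArc_add ha hb)
    · exact Or.inl (eq_of_inArc_add ha hb)
    · exact absurd (by rw [arcFill_of_not_inArc ha, arcFill_of_not_inArc hb, hv]) h
  · rintro (rfl | rfl)
    · rw [arcFill_of_not_inArc (not_inArc_self ht), arcFill_of_inArc (inArc_add_self h1)]
      exact hb.symm
    · rw [arcFill_of_inArc (inArc_end h1), arcFill_of_not_inArc (not_inArc_end_add ht), hv, hvt]
      exact hb

/-- The filled word shows `v p` at `p`, `b` at `p + c`, and the end of the arc as its other jump; on
the arc, periodicity gives `v` the value `v p`. -/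
theorem arcFill_injective {c p : G} {v v' : G → A} {t t' : ℕ} {b b' : A} (hv : Periodic v c)
    (hv' : Periodic v' c) (h1 : 1 ≤ t) (h1' : 1 ≤ t') (ht : t < addOrderOf c)
    (ht' : t' < addOrderOf c) (hb : b ≠ v p) (hb' : b' ≠ v' p)
    (h : arcFill c v p t b = arcFill c v' p t' b') : v = v' ∧ t = t' ∧ b = b' := by
  have hp : v p = v' p := by
    have := congrFun h p
    rwa [arcFill_of_not_inArc (not_inArc_self ht),
      arcFill_of_not_inArc (not_inArc_self ht')] at this
  have hbb : b = b' := by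
    have := congrFun h (p + c)
    rwa [arcFill_of_inArc (inArc_add_self h1), arcFill_of_inArc (inArc_add_self h1')] at this
  have htt : t = t' := by
    have hm : p + t • c ∈ changes (arcFill c v' p t' b') c := by
      rw [← h, changes_arcFill hv h1 ht hb]; simp
    rw [changes_arcFill hv' h1' ht' hb', mem_insert, mem_singleton] at hm
    rcases hm with hm | hm
    · have := nsmul_ne_of_lt_addOrderOf (p := p) (t := 0) ht (by omega) (by simpa using hm)
      omega
    · exact nsmul_ne_of_lt_addOrderOf ht ht' hm
  subst htt hbb
  refine ⟨funext fun x => ?_, rfl, rfl⟩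
  by_cases hx : InArc c p t x
  · obtain ⟨s, -, -, rfl⟩ := hx
    rw [hv.nsmul s p, hv'.nsmul s p, hp]
  · have := congrFun h x
    rwa [arcFill_of_not_inArc hx, arcFill_of_not_inArc hx] at this

/-- Walk from `p` in steps of `c`: the letter is constant up to the other jump `q`, then constant
again until the walk closes at `p`. -/
theorem exists_arcFill {c p : G} {f : G → A} (h2 : (changes f c).card = 2)
    (hp : p ∈ changes f c) : ∃ (v : G → A) (t : ℕ) (b : A), Periodic v c ∧ 1 ≤ t ∧
      t < addOrderOf c ∧ b ≠ v p ∧ f = arcFill c v p t b := by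
  obtain ⟨q, hq⟩ : ∃ q, (changes f c).erase p = {q} := by
    rw [← card_eq_one, card_erase_of_mem hp, h2]
  have hqp : q ≠ p := by
    have : q ∈ (changes f c).erase p := by rw [hq]; simp
    exact (mem_erase.1 this).1
  have hstep : ∀ x, x ≠ p → x ≠ q → f (x + c) = f x := by
    intro x h1 h3
    by_contra h
    have : x ∈ (changes f c).erase p := mem_erase.2 ⟨h1, mem_changes.2 (Ne.symm h)⟩
    rw [hq, mem_singleton] at this
    exact h3 this
  set L := addOrderOf c with hL
  have hL0 : 0 < L := addOrderOf_pos c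
  have hLc : L • c = 0 := addOrderOf_nsmul_eq_zero c
  have hpne : ∀ s, 1 ≤ s → s < L → p + s • c ≠ p := by
    intro s h1 h3 h
    have := nsmul_ne_of_lt_addOrderOf (p := p) (t := 0) h3 hL0 (by simpa using h)
    omega
  have hrun : ∀ m u : ℕ, (∀ s : ℕ, u ≤ s → s < u + m → p + s • c ≠ p ∧ p + s • c ≠ q) →
      f (p + (u + m) • c) = f (p + u • c) := by
    intro m u hm
    induction m with
    | zero => simp
    | succ m ih =>
      rw [← ih fun s h1 h3 => hm s h1 (by omega), ← add_assoc, succ_nsmul, ← add_assoc]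
      exact hstep _ (hm (u + m) (by omega) (by omega)).1 (hm (u + m) (by omega) (by omega)).2
  -- If the walk missed `q`, the letter at `p + c` would persist up to `p + L • c = p`, against the
  -- jump at `p`.
  obtain ⟨t, ht1, htL, rfl⟩ : ∃ t, 1 ≤ t ∧ t < L ∧ q = p + t • c := by
    by_contra! hno
    have h := hrun (L - 1) 1 fun s h1 h3 =>
      ⟨hpne s h1 (by omega), (hno s h1 (by omega)).symm⟩
    rw [Nat.add_sub_cancel' hL0, hLc, add_zero, one_nsmul] at h
    exact mem_changes.1 hp h
  have hin : ∀ x, InArc c p t x → f x = f (p + c) := by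
    rintro x ⟨s, h1, h3, rfl⟩
    have h := hrun (s - 1) 1 fun u h4 h5 => ⟨hpne u h4 (by omega), fun h => by
      have := nsmul_ne_of_lt_addOrderOf (by omega) htL h
      omega⟩
    rwa [Nat.add_sub_cancel' h1, one_nsmul] at h
  have hend : f (p + t • c + c) = f p := by
    have h := hrun (L - (t + 1)) (t + 1) fun u h4 h5 => ⟨hpne u (by omega) (by omega), fun h => by
      have := nsmul_ne_of_lt_addOrderOf (by omega) htL h
      omega⟩
    rw [Nat.add_sub_cancel' htL, hLc, add_zero, succ_nsmul, ← add_assoc] at h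
    exact h.symm
  -- The periodic word is recovered by writing `f p`, the letter on both sides of the arc, back onto
  -- it.
  refine ⟨arcFill c f p t (f p), t, f (p + c), ?_, ht1, htL, ?_, ?_⟩
  · intro x
    by_cases h1 : InArc c p t x <;> by_cases h3 : InArc c p t (x + c)
    · rw [arcFill_of_inArc h1, arcFill_of_inArc h3]
    · rw [arcFill_of_inArc h1, arcFill_of_not_inArc h3, eq_of_not_inArc_add h1 h3, hend]
    · rw [arcFill_of_not_inArc h1, arcFill_of_inArc h3, eq_of_inArc_add h1 h3]
    · rw [arcFill_of_not_inArc h1, arcFill_of_not_inArc h3]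
      refine hstep x ?_ ?_
      · rintro rfl; exact h3 (inArc_add_self ht1)
      · rintro rfl; exact h1 (inArc_end ht1)
  · rw [arcFill_of_not_inArc (not_inArc_self htL)]
    exact (mem_changes.1 hp).symm
  · funext x
    by_cases h1 : InArc c p t x
    · rw [arcFill_of_inArc h1, hin x h1]
    · rw [arcFill_of_not_inArc h1, arcFill_of_not_inArc h1]

-- Both sides count pairs (word, jump). With the jump `p` fixed, `arcFill` is a bijection from
-- triples `(v, t, b)`: there are `addOrderOf c - 1` arc lengths and `b` avoids one letter.
open Classical in
theorem two_mul_card_changes_eq_two [Fintype A] (c : G) :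
    2 * (univ.filter fun f : G → A => (changes f c).card = 2).card =
      (univ.filter fun v : G → A => Periodic v c).card * Fintype.card G * (addOrderOf c - 1) *
        (Fintype.card A - 1) := by
  have hT : ((univ.filter fun f : G → A => (changes f c).card = 2).sigma
      fun f => changes f c).card =
      2 * (univ.filter fun f : G → A => (changes f c).card = 2).card := by
    rw [card_sigma, sum_congr rfl fun f hf => (mem_filter.1 hf).2, sum_const, smul_eq_mul, mul_comm]
  have hS : (((univ.filter fun v : G → A => Periodic v c) ×ˢ (univ : Finset G) ×ˢ
      Icc 1 (addOrderOf c - 1)).sigma fun a => univ.erase (a.1 a.2.1)).card =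
      (univ.filter fun v : G → A => Periodic v c).card * Fintype.card G * (addOrderOf c - 1) *
        (Fintype.card A - 1) := by
    rw [card_sigma, sum_congr rfl fun a _ => card_erase_of_mem (mem_univ _), sum_const,
      smul_eq_mul, card_product, card_product, Nat.card_Icc, card_univ, card_univ, mul_assoc,
      Nat.add_sub_cancel]
    ring
  have hL0 : 0 < addOrderOf c := addOrderOf_pos c
  rw [← hT, ← hS]
  symm
  refine card_bij (fun a _ => ⟨arcFill c a.1.1 a.1.2.1 a.1.2.2 a.2, a.1.2.1⟩) ?_ ?_ ?_
  · rintro ⟨⟨v, p, t⟩, b⟩ ha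
    simp only [mem_sigma, mem_product, mem_filter, mem_univ, true_and, mem_Icc, mem_erase,
      and_true] at ha ⊢
    obtain ⟨⟨hv, h1, ht⟩, hb⟩ := ha
    have ht' : t < addOrderOf c := by omega
    rw [changes_arcFill hv h1 ht' hb]
    refine ⟨card_pair fun h => ?_, by simp⟩
    have := nsmul_ne_of_lt_addOrderOf (c := c) (p := p) (s := 0) hL0 ht' (by simpa using h)
    omega
  · rintro ⟨⟨v, p, t⟩, b⟩ ha ⟨⟨v', p', t'⟩, b'⟩ ha' h
    simp only [mem_sigma, mem_product, mem_filter, mem_univ, true_and, mem_Icc, mem_erase,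
      and_true] at ha ha'
    simp only [Sigma.mk.injEq, heq_eq_eq] at h
    obtain ⟨h, rfl⟩ := h
    obtain ⟨rfl, rfl, rfl⟩ := arcFill_injective ha.1.1 ha'.1.1 ha.1.2.1 ha'.1.2.1
      (by omega) (by omega) ha.2 ha'.2 h
    rfl
  · rintro ⟨f, p⟩ hf
    simp only [mem_sigma, mem_filter, mem_univ, true_and] at hf
    obtain ⟨v, t, b, hv, h1, ht, hb, rfl⟩ := exists_arcFill hf.1 hf.2
    refine ⟨⟨⟨v, p, t⟩, b⟩, ?_, rfl⟩
    simp only [mem_sigma, mem_product, mem_filter, mem_univ, true_and, mem_Icc, mem_erase, and_true]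
    exact ⟨⟨hv, h1, by omega⟩, hb⟩

end Arc

/-! ### Periods, primitive words and Möbius inversion -/

section Period
variable {A : Type*}

/-- The cyclic left shift by one position. -/
def shift {m : ℕ} (f : ZMod m → A) : ZMod m → A := fun x => f (x + 1)

theorem shift_iterate {m : ℕ} (d : ℕ) (f : ZMod m → A) :
    shift^[d] f = fun x => f (x + d) := by
  induction d generalizing f with
  | zero => simp
  | succ d ih =>
    rw [iterate_succ_apply, ih]
    funext x
    simp [shift, add_assoc]

/-- Viewing periods as those of a point under iteration makes gcds and `minimalPeriod` available. -/
theorem isPeriodicPt_shift {m : ℕ} {f : ZMod m → A} {d : ℕ} :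
    IsPeriodicPt shift d f ↔ Periodic f (d : ZMod m) := by
  rw [IsPeriodicPt, IsFixedPt, shift_iterate, funext_iff]
  rfl

theorem periodic_gcd {m : ℕ} {f : ZMod m → A} {d e : ℕ} (hd : Periodic f (d : ZMod m))
    (he : Periodic f (e : ZMod m)) : Periodic f ((d.gcd e : ℕ) : ZMod m) :=
  isPeriodicPt_shift.1 ((isPeriodicPt_shift.2 hd).gcd (isPeriodicPt_shift.2 he))

theorem periodic_self {m : ℕ} (f : ZMod m → A) : Periodic f (m : ZMod m) := by
  intro x; simp

theorem periodic_of_dvd {m : ℕ} {f : ZMod m → A} {d e : ℕ} (hde : d ∣ e)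
    (hd : Periodic f (d : ZMod m)) : Periodic f (e : ZMod m) := by
  rw [← isPeriodicPt_shift] at hd ⊢
  exact hd.trans_dvd hde

theorem minimalPeriod_shift_dvd {m : ℕ} (f : ZMod m → A) : minimalPeriod shift f ∣ m :=
  (isPeriodicPt_shift.2 (periodic_self f)).minimalPeriod_dvd

theorem minimalPeriod_shift_ne_iff {m : ℕ} [NeZero m] {f : ZMod m → A} :
    minimalPeriod shift f ≠ m ↔ ∃ d, d ∣ m ∧ d < m ∧ Periodic f (d : ZMod m) := by
  have hm : 0 < m := Nat.pos_of_ne_zero (NeZero.ne m)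
  constructor
  · intro h
    have hd := minimalPeriod_shift_dvd f
    exact ⟨_, hd, lt_of_le_of_ne (Nat.le_of_dvd hm hd) h,
      isPeriodicPt_shift.1 (isPeriodicPt_minimalPeriod shift f)⟩
  · rintro ⟨d, hd, hlt, hp⟩ h
    have h1 := (isPeriodicPt_shift.2 hp).minimalPeriod_dvd
    have := Nat.le_of_dvd (Nat.pos_of_dvd_of_pos hd hm) h1
    omega

/-- The `d`-periodic word of length `m` with a given block. -/
def pull {d m : ℕ} (h : d ∣ m) (f : ZMod d → A) : ZMod m → A :=
  fun x => f (ZMod.castHom h (ZMod d) x)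

theorem pull_injective {d m : ℕ} (h : d ∣ m) : Injective (pull (A := A) h) := by
  intro f g hfg
  funext y
  obtain ⟨x, rfl⟩ := ZMod.castHom_surjective h y
  exact congrFun hfg x

theorem periodic_pull {d m : ℕ} (h : d ∣ m) {f : ZMod d → A} {j : ℕ} :
    Periodic (pull h f) (j : ZMod m) ↔ Periodic f (j : ZMod d) := by
  constructor
  · intro hp y
    obtain ⟨x, rfl⟩ := ZMod.castHom_surjective h y
    have := hp x
    rwa [pull, pull, map_add, map_natCast] at this
  · intro hp x
    have := hp (ZMod.castHom h (ZMod d) x)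
    rwa [pull, pull, map_add, map_natCast]

/-- The block is read off at the representatives `y.val`; from `x.val % d` to `x` there are `x.val /
d` whole periods. -/
theorem exists_pull {d m : ℕ} [NeZero m] (h : d ∣ m) {f : ZMod m → A}
    (hf : Periodic f (d : ZMod m)) : ∃ v, pull h v = f := by
  have hm : 0 < m := Nat.pos_of_ne_zero (NeZero.ne m)
  have : NeZero d := ⟨(Nat.pos_of_dvd_of_pos h hm).ne'⟩
  refine ⟨fun y => f (y.val : ZMod m), funext fun x => ?_⟩
  have hx : ZMod.castHom h (ZMod d) x = ((x.val : ℕ) : ZMod d) := by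
    conv_lhs => rw [← ZMod.natCast_zmod_val x]
    simp
  have h1 := hf.nsmul (x.val / d) ((x.val % d : ℕ) : ZMod m)
  rw [nsmul_eq_mul, ← Nat.cast_mul, ← Nat.cast_add, mul_comm, Nat.mod_add_div,
    ZMod.natCast_zmod_val] at h1
  rw [pull, hx, ZMod.val_natCast, h1]

theorem minimalPeriod_pull {d m : ℕ} (h : d ∣ m) (f : ZMod d → A) :
    minimalPeriod shift (pull h f) = minimalPeriod shift f := by
  refine Nat.dvd_antisymm ?_ ?_
  · rw [← isPeriodicPt_iff_minimalPeriod_dvd, isPeriodicPt_shift, periodic_pull,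
      ← isPeriodicPt_shift]
    exact isPeriodicPt_minimalPeriod _ _
  · rw [← isPeriodicPt_iff_minimalPeriod_dvd, isPeriodicPt_shift, ← periodic_pull h,
      ← isPeriodicPt_shift]
    exact isPeriodicPt_minimalPeriod _ _

theorem periodic_iff_gcd {m i : ℕ} {f : ZMod m → A} :
    Periodic f (i : ZMod m) ↔ Periodic f ((m.gcd i : ℕ) : ZMod m) :=
  ⟨fun h => periodic_gcd (periodic_self f) h, periodic_of_dvd (Nat.gcd_dvd_right m i)⟩

variable (A) in
/-- The number of primitive words of length `m`. -/
noncomputable def primitiveCount (m : ℕ) : ℕ :=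
  Nat.card {f : ZMod m → A // minimalPeriod shift f = m}

theorem card_minimalPeriod_eq {d m : ℕ} [NeZero m] (h : d ∣ m) :
    Nat.card {f : ZMod m → A // minimalPeriod shift f = d} = primitiveCount A d := by
  symm
  refine Nat.card_eq_of_bijective
    (fun f => ⟨pull h f.1, (minimalPeriod_pull h f.1).trans f.2⟩) ⟨?_, ?_⟩
  · intro f g hfg
    exact Subtype.ext (pull_injective h (congrArg Subtype.val hfg))
  · rintro ⟨f, hf⟩
    obtain ⟨v, rfl⟩ := exists_pull h (isPeriodicPt_shift.1 (hf ▸ isPeriodicPt_minimalPeriod shift f))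
    exact ⟨⟨v, (minimalPeriod_pull h v).symm.trans hf⟩, rfl⟩

variable [Fintype A]

theorem card_words (m : ℕ) [NeZero m] : Nat.card (ZMod m → A) = Fintype.card A ^ m := by
  classical
  rw [Nat.card_eq_fintype_card, Fintype.card_fun, ZMod.card]

theorem card_periodic_of_dvd {d m : ℕ} [NeZero m] (h : d ∣ m) :
    Nat.card {v : ZMod m → A // Periodic v (d : ZMod m)} = Fintype.card A ^ d := by
  have hm : 0 < m := Nat.pos_of_ne_zero (NeZero.ne m)
  have : NeZero d := ⟨(Nat.pos_of_dvd_of_pos h hm).ne'⟩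
  rw [← card_words d]
  symm
  refine Nat.card_eq_of_bijective
    (fun f => ⟨pull h f, (periodic_pull h).2 (periodic_self f)⟩) ⟨?_, ?_⟩
  · intro f g hfg
    exact pull_injective h (congrArg Subtype.val hfg)
  · rintro ⟨f, hf⟩
    obtain ⟨v, rfl⟩ := exists_pull h hf
    exact ⟨v, rfl⟩

theorem sum_primitiveCount (m : ℕ) (hm : 0 < m) :
    ∑ d ∈ m.divisors, primitiveCount A d = Fintype.card A ^ m := by
  classical
  have : NeZero m := ⟨hm.ne'⟩
  rw [← card_words m, Nat.card_eq_fintype_card, ← card_univ,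
    card_eq_sum_card_fiberwise (f := fun f : ZMod m → A => minimalPeriod shift f)
      (t := m.divisors) fun f _ => by
        simpa [hm.ne'] using minimalPeriod_shift_dvd f]
  refine sum_congr rfl fun d hd => ?_
  rw [← card_minimalPeriod_eq (Nat.dvd_of_mem_divisors hd), Nat.card_eq_fintype_card,
    Fintype.card_subtype]

theorem primitiveCount_eq (m : ℕ) (hm : 0 < m) :
    (primitiveCount A m : ℤ) =
      ∑ d ∈ m.divisors, ArithmeticFunction.moebius d * (Fintype.card A : ℤ) ^ (m / d) := by
  have h := (ArithmeticFunction.sum_eq_iff_sum_mul_moebius_eq (R := ℤ)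
    (f := fun d => (primitiveCount A d : ℤ)) (g := fun d => (Fintype.card A : ℤ) ^ d)).1
    (fun n hn => by exact_mod_cast sum_primitiveCount n hn) m hm
  rw [← h]
  simpa using Nat.sum_divisorsAntidiagonal (n := m) fun a b =>
    ArithmeticFunction.moebius a * (Fintype.card A : ℤ) ^ b

theorem card_imprimitive_add (m : ℕ) [NeZero m] :
    Nat.card {f : ZMod m → A // ∃ d, d ∣ m ∧ d < m ∧ Periodic f (d : ZMod m)} +
      primitiveCount A m = Fintype.card A ^ m := by
  classical
  simp_rw [← minimalPeriod_shift_ne_iff, primitiveCount]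
  rw [Nat.card_eq_fintype_card, Nat.card_eq_fintype_card, ← card_words m,
    Nat.card_eq_fintype_card, Fintype.card_subtype_compl, Nat.sub_add_cancel]
  exact Fintype.card_subtype_le _

end Period

/-! ### Words already counted by a smaller shift -/

section Bad
variable {A : Type*} {n i : ℕ}

/-- Some shift by `d < i`, with `d` dividing both `n` and `i`, fixes the word. -/
def HasProperPeriod (i : ℕ) (v : ZMod n → A) : Prop :=
  ∃ d, d ∣ n.gcd i ∧ d < i ∧ Periodic v (d : ZMod n)

theorem HasProperPeriod.periodic {v : ZMod n → A} (h : HasProperPeriod i v) :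
    Periodic v (i : ZMod n) := by
  obtain ⟨d, hd, -, hv⟩ := h
  exact periodic_of_dvd (hd.trans (Nat.gcd_dvd_right n i)) hv

/-- Here `n.gcd i < i`, so the gcd itself serves as the proper period of every `i`-periodic word. -/
theorem card_hasProperPeriod_of_not_dvd [NeZero n] [Fintype A] (h1 : 1 ≤ i) (h : ¬ i ∣ n) :
    Nat.card {v : ZMod n → A // HasProperPeriod i v} = Fintype.card A ^ n.gcd i := by
  rw [← card_periodic_of_dvd (A := A) (m := n) (Nat.gcd_dvd_left n i)]
  have hlt : n.gcd i < i := lt_of_le_of_ne (Nat.le_of_dvd h1 (Nat.gcd_dvd_right n i))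
    fun he => h (he ▸ Nat.gcd_dvd_left n i)
  refine Nat.card_congr (Equiv.subtypeEquivRight fun v => ⟨fun hv => ?_, fun hv => ?_⟩)
  · exact periodic_iff_gcd.1 hv.periodic
  · exact ⟨_, dvd_rfl, hlt, hv⟩

/-- Here `n.gcd i = i`, and the condition bears on the block of length `i` alone: it must be
imprimitive. -/
theorem card_hasProperPeriod_of_dvd [NeZero n] (h : i ∣ n) :
    Nat.card {v : ZMod n → A // HasProperPeriod i v} =
      Nat.card {f : ZMod i → A // ∃ d, d ∣ i ∧ d < i ∧ Periodic f (d : ZMod i)} := by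
  symm
  have hg : n.gcd i = i := Nat.gcd_eq_right h
  refine Nat.card_eq_of_bijective (fun f => ⟨pull h f.1, ?_⟩) ⟨?_, ?_⟩
  · obtain ⟨d, hd, hlt, hp⟩ := f.2
    exact ⟨d, by rwa [hg], hlt, (periodic_pull h).2 hp⟩
  · intro f g hfg
    exact Subtype.ext (pull_injective h (congrArg Subtype.val hfg))
  · rintro ⟨f, hf⟩
    obtain ⟨v, rfl⟩ := exists_pull h hf.periodic
    obtain ⟨d, hd, hlt, hp⟩ := hf
    exact ⟨⟨v, d, by rwa [hg] at hd, hlt, (periodic_pull h).1 hp⟩, rfl⟩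

variable [DecidableEq A]

theorem natCast_ne_zero_of_lt {j : ℕ} (h0 : 0 < j) (h : j < n) : (j : ZMod n) ≠ 0 := by
  rw [Ne, ZMod.natCast_eq_zero_iff]
  exact fun hd => absurd (Nat.le_of_dvd h0 hd) (by omega)

/-- `f` is at distance two from its shift by `i` and by some smaller positive amount. -/
def RepeatShift [NeZero n] (i : ℕ) (f : ZMod n → A) : Prop :=
  (changes f (i : ZMod n)).card = 2 ∧
    ∃ j, 1 ≤ j ∧ j < i ∧ (changes f (j : ZMod n)).card = 2

theorem repeatShift_iff [NeZero n] {F : A → ℤ} (hF : Injective F) (h1 : 1 ≤ i) (h2 : i ≤ n / 2)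
    {f : ZMod n → A} : RepeatShift i f ↔
      ∃ (v : ZMod n → A) (x : ZMod n) (b : A), HasProperPeriod i v ∧ b ≠ v x ∧
        f = update v x b := by
  have hn : 0 < n := Nat.pos_of_ne_zero (NeZero.ne n)
  have hi0 : (i : ZMod n) ≠ 0 := natCast_ne_zero_of_lt h1 (by omega)
  constructor
  · rintro ⟨hi, j, hj1, hji, hj⟩
    have hij : (i : ZMod n) ≠ j := by
      intro h
      rw [ZMod.natCast_eq_natCast_iff', Nat.mod_eq_of_lt (by omega),
        Nat.mod_eq_of_lt (by omega)] at h
      omega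
    -- The bound `j < i ≤ n / 2` keeps `i + j` below `n`, so the two shifts are not opposite.
    have hadd : (i : ZMod n) + j ≠ 0 := by
      rw [← Nat.cast_add]
      exact natCast_ne_zero_of_lt (by omega) (by omega)
    obtain ⟨v, x, b, hvi, hvj, hb, rfl⟩ := exists_periodic_of_card_changes hF hi0
      (natCast_ne_zero_of_lt hj1 (by omega)) hij hadd hi hj
    refine ⟨v, x, b, ⟨(n.gcd i).gcd j, Nat.gcd_dvd_left _ _, ?_, ?_⟩, hb, rfl⟩
    · exact lt_of_le_of_lt (Nat.le_of_dvd hj1 (Nat.gcd_dvd_right _ _)) hji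
    · exact periodic_gcd (periodic_iff_gcd.1 hvi) hvj
  · rintro ⟨v, x, b, hv, hb, rfl⟩
    refine ⟨card_changes_update hi0 hv.periodic hb, ?_⟩
    obtain ⟨d, hd, hlt, hp⟩ := hv
    have hd0 : 0 < d := Nat.pos_of_dvd_of_pos hd (Nat.gcd_pos_of_pos_left _ hn)
    exact ⟨d, hd0, hlt, card_changes_update (natCast_ne_zero_of_lt hd0 (by omega)) hp hb⟩

/-- `v` and `v'` differ at most at `x` and `x'`, yet the set where they differ is invariant under
translation by `g = n.gcd i`. If `g < i`, then `2 * g < n` and a difference at `y` yields three: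
`y`, `y + g`, `y + 2g`. If `g = i`, the proper periods `d` of `v` and `e` of `v'` are at most `g /
2` and lead to positions where the words agree. -/
theorem eq_of_update_eq [NeZero n] (h1 : 1 ≤ i) (h2 : i ≤ n / 2) {v v' : ZMod n → A}
    (hv : HasProperPeriod i v) (hv' : HasProperPeriod i v') {x x' : ZMod n} {b b' : A}
    (h : update v x b = update v' x' b') : v = v' := by
  have hn : 0 < n := Nat.pos_of_ne_zero (NeZero.ne n)
  have hg0 : 0 < n.gcd i := Nat.gcd_pos_of_pos_left _ hn
  have hgi : n.gcd i ≤ i := Nat.le_of_dvd h1 (Nat.gcd_dvd_right n i)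
  have hvg := periodic_iff_gcd.1 hv.periodic
  have hvg' := periodic_iff_gcd.1 hv'.periodic
  set g := n.gcd i with hg
  have hout : ∀ z, z ≠ x → z ≠ x' → v z = v' z := by
    intro z hx hx'
    have := congrFun h z
    rwa [update_of_ne hx, update_of_ne hx'] at this
  have hne : ∀ {r s : ℕ} (z : ZMod n), r < s → s < n → z + (s : ZMod n) ≠ z + r := by
    intro r s z hr hs hz
    have := add_left_cancel hz
    rw [ZMod.natCast_eq_natCast_iff', Nat.mod_eq_of_lt hs, Nat.mod_eq_of_lt (by omega)] at this
    omega
  have hne0 : ∀ {s : ℕ} (z : ZMod n), 0 < s → s < n → z + (s : ZMod n) ≠ z := by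
    intro s z hs hsn
    simpa using hne z hs hsn
  by_contra hvv
  obtain ⟨y, hy⟩ : ∃ y, v y ≠ v' y := by
    by_contra! hall
    exact hvv (funext hall)
  have hyg : v (y + g) ≠ v' (y + g) := by rwa [hvg, hvg']
  have hyx : y = x ∨ y = x' := by
    by_contra! hc
    exact hy (hout y hc.1 hc.2)
  have hygx : y + g = x ∨ y + g = x' := by
    by_contra! hc
    exact hyg (hout _ hc.1 hc.2)
  have hyg_ne := hne0 y hg0 (by omega)
  have hout' : ∀ z, z ≠ y → z ≠ y + g → v z = v' z := by
    intro z hz1 hz2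
    apply hout z <;> grind
  rcases hgi.lt_or_eq with hlt | heq
  · have h2g : 2 * g < n := by omega
    have h3 : v (y + (2 * g : ℕ)) = v' (y + (2 * g : ℕ)) :=
      hout' _ (hne0 y (by omega) h2g) (hne y (by omega) h2g)
    have e1 : Periodic v ((2 * g : ℕ) : ZMod n) := periodic_of_dvd (Dvd.intro_left 2 rfl) hvg
    have e2 : Periodic v' ((2 * g : ℕ) : ZMod n) := periodic_of_dvd (Dvd.intro_left 2 rfl) hvg'
    rw [e1, e2] at h3
    exact hy h3
  · obtain ⟨d, hd, hdi, hp⟩ := hv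
    obtain ⟨e, he, hei, hp'⟩ := hv'
    rw [← hg] at hd he
    have hsmall : ∀ d, d ∣ g → d < i → 0 < d ∧ 2 * d ≤ g := by
      rintro d ⟨q, hq⟩ hdi
      have hd0 : 0 < d := Nat.pos_of_ne_zero (by rintro rfl; omega)
      have hq2 : 2 ≤ q := by
        by_contra hq2
        have : q ≤ 1 := by omega
        have : d * q ≤ d * 1 := Nat.mul_le_mul_left d this
        omega
      have : d * 2 ≤ d * q := Nat.mul_le_mul_left d hq2
      exact ⟨hd0, by omega⟩
    obtain ⟨hd0, hd2⟩ := hsmall d hd hdi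
    obtain ⟨he0, he2⟩ := hsmall e he hei
    have a1 : v (y + d) = v' (y + d) :=
      hout' _ (hne0 y hd0 (by omega)) (hne y (by omega) (by omega)).symm
    have a2 : v (y + e) = v' (y + e) :=
      hout' _ (hne0 y he0 (by omega)) (hne y (by omega) (by omega)).symm
    -- Equality forces `d = e`, and agreement at `y + d` carries back to `y`.
    by_cases hde : d + e = g
    · have : d = e := by omega
      subst this
      rw [hp, hp'] at a1
      exact hy a1
    -- Now `y + d + e` also avoids `y` and `y + g`, and v(y) = v'(y + d) = v(y + e) = v'(y).
    · have a3 : v (y + (d + e : ℕ)) = v' (y + (d + e : ℕ)) :=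
        hout' _ (hne0 y (by omega) (by omega)) (hne y (by omega) (by omega)).symm
      rw [Nat.cast_add, ← add_assoc, hp', add_right_comm, hp] at a3
      rw [hp] at a1
      rw [hp'] at a2
      exact hy (a1.trans (a3.symm.trans a2))

theorem card_repeatShift [NeZero n] [Fintype A] {F : A → ℤ} (hF : Injective F) (h1 : 1 ≤ i)
    (h2 : i ≤ n / 2) : Nat.card {f : ZMod n → A // RepeatShift i f} =
      Nat.card {v : ZMod n → A // HasProperPeriod i v} * n * (Fintype.card A - 1) := by
  classical
  have hS : (((univ.filter fun v : ZMod n → A => HasProperPeriod i v) ×ˢ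
      (univ : Finset (ZMod n))).sigma fun a => univ.erase (a.1 a.2)).card =
      (univ.filter fun v : ZMod n → A => HasProperPeriod i v).card * n *
        (Fintype.card A - 1) := by
    rw [card_sigma, sum_congr rfl fun a _ => card_erase_of_mem (mem_univ _), sum_const,
      smul_eq_mul, card_product, card_univ, card_univ, ZMod.card]
  rw [Nat.card_eq_fintype_card, Nat.card_eq_fintype_card, Fintype.card_subtype,
    Fintype.card_subtype, ← hS]
  symm
  refine card_bij (fun a _ => update a.1.1 a.1.2 a.2) ?_ ?_ ?_
  · rintro ⟨⟨v, x⟩, b⟩ ha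
    simp only [mem_sigma, mem_product, mem_filter, mem_univ, true_and, mem_erase,
      and_true] at ha ⊢
    exact (repeatShift_iff hF h1 h2).2 ⟨v, x, b, ha.1, ha.2, rfl⟩
  · rintro ⟨⟨v, x⟩, b⟩ ha ⟨⟨v', x'⟩, b'⟩ ha' h
    simp only [mem_sigma, mem_product, mem_filter, mem_univ, true_and, mem_erase,
      and_true] at ha ha' h
    obtain rfl := eq_of_update_eq h1 h2 ha.1 ha'.1 h
    have hx : x = x' := by
      by_contra hx
      have := congrFun h x
      rw [update_self, update_of_ne hx] at this
      exact ha.2 this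
    subst hx
    rw [update_injective v x h]
  · intro f hf
    simp only [mem_filter, mem_univ, true_and] at hf
    obtain ⟨v, x, b, hv, hb, rfl⟩ := (repeatShift_iff hF h1 h2).1 hf
    exact ⟨⟨⟨v, x⟩, b⟩, by simp [hv, hb], rfl⟩

/-- `f` is at distance two from its shift by `i` but by no smaller positive amount. -/
def FirstShift [NeZero n] (i : ℕ) (f : ZMod n → A) : Prop :=
  (changes f (i : ZMod n)).card = 2 ∧
    ∀ j, 1 ≤ j → j < i → (changes f (j : ZMod n)).card ≠ 2

theorem two_mul_card_firstShift [NeZero n] [Fintype A] {F : A → ℤ} (hF : Injective F) (h1 : 1 ≤ i)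
    (h2 : i ≤ n / 2) :
    2 * Nat.card {f : ZMod n → A // FirstShift i f} +
      2 * (Nat.card {v : ZMod n → A // HasProperPeriod i v} * n * (Fintype.card A - 1)) =
      Fintype.card A ^ n.gcd i * n * (n / n.gcd i - 1) * (Fintype.card A - 1) := by
  classical
  have hcount := two_mul_card_changes_eq_two (A := A) (i : ZMod n)
  rw [ZMod.addOrderOf_coe i (NeZero.ne n), ZMod.card] at hcount
  have hper : (univ.filter fun v : ZMod n → A => Periodic v (i : ZMod n)).card =
      Fintype.card A ^ n.gcd i := by
    rw [← card_periodic_of_dvd (A := A) (m := n) (Nat.gcd_dvd_left n i),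
      Nat.card_eq_fintype_card, Fintype.card_subtype]
    exact congrArg card (filter_congr fun v _ => periodic_iff_gcd)
  rw [hper] at hcount
  rw [← hcount, ← card_repeatShift hF h1 h2, ← mul_add, Nat.card_eq_fintype_card,
    Nat.card_eq_fintype_card, Fintype.card_subtype, Fintype.card_subtype,
    ← card_union_of_disjoint]
  · congr 2
    ext f
    simp only [mem_union, mem_filter, mem_univ, true_and, FirstShift, RepeatShift]
    grind
  · rw [disjoint_filter]
    rintro f - ⟨-, hf⟩ ⟨-, j, hj1, hj2, hj⟩
    exact hf j hj1 hj2 hj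

end Bad

/-! ### From lists to functions on `ZMod m` -/

section Words
variable {A : Type*} {m : ℕ}

/-- A list of length `m` as a function on `ZMod m`. -/
def cyclicWord [NeZero m] (u : List A) (hu : u.length = m) : ZMod m → A :=
  fun x => u[x.val]'(hu ▸ ZMod.val_lt x)

theorem getElem?_val_eq_some [NeZero m] {u : List A} (hu : u.length = m) (x : ZMod m) :
    u[x.val]? = some (cyclicWord u hu x) :=
  List.getElem?_eq_getElem _

theorem cyclicWord_injective [NeZero m] {u v : List A} (hu : u.length = m) (hv : v.length = m)
    (h : cyclicWord u hu = cyclicWord v hv) : u = v := by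
  refine List.ext_getElem (hu.trans hv.symm) fun p hp hp' => ?_
  have h1 := congrFun h (p : ZMod m)
  simpa [cyclicWord, ZMod.val_natCast_of_lt (hu ▸ hp : p < m)] using h1

theorem exists_cyclicWord [NeZero m] (f : ZMod m → A) :
    ∃ (u : List A) (hu : u.length = m), cyclicWord u hu = f := by
  refine ⟨List.ofFn fun j : Fin m => f (j : ℕ), by simp, funext fun x => ?_⟩
  simp [cyclicWord]

theorem ncard_eq_card_cyclicWord [NeZero m] {P : List A → Prop} {Q : (ZMod m → A) → Prop}
    (h : ∀ u (hu : u.length = m), P u ↔ Q (cyclicWord u hu)) :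
    {u : List A | u.length = m ∧ P u}.ncard = Nat.card {f : ZMod m → A // Q f} := by
  rw [← Nat.card_coe_set_eq]
  refine Nat.card_eq_of_bijective
    (fun u => ⟨cyclicWord u.1 u.2.1, (h u.1 u.2.1).1 u.2.2⟩) ⟨?_, ?_⟩
  · intro u v huv
    exact Subtype.ext (cyclicWord_injective u.2.1 v.2.1 (congrArg Subtype.val huv))
  · rintro ⟨f, hf⟩
    obtain ⟨u, hu, rfl⟩ := exists_cyclicWord f
    exact ⟨⟨u, hu, (h u hu).2 hf⟩, rfl⟩

theorem getElem?_rotate_val [NeZero m] {u : List A} (hu : u.length = m) (i : ℕ) (x : ZMod m) :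
    (u.rotate i)[x.val]? = some (cyclicWord u hu (x + i)) := by
  rw [List.getElem?_rotate (hu ▸ ZMod.val_lt x), ← getElem?_val_eq_some hu, ZMod.val_add,
    ZMod.val_natCast, Nat.add_mod_mod, hu]

theorem ham_rotate [NeZero m] [DecidableEq A] {u : List A} (hu : u.length = m) (i : ℕ) :
    ham u (u.rotate i) = (changes (cyclicWord u hu) (i : ZMod m)).card := by
  have hval : ∀ x : ZMod m, x ∈ changes (cyclicWord u hu) (i : ZMod m) ↔
      u[x.val]? ≠ (u.rotate i)[x.val]? := fun x => by
    rw [mem_changes, getElem?_rotate_val hu, getElem?_val_eq_some hu, Ne, Ne, Option.some_inj]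
  symm
  refine card_bij (fun x _ => x.val) ?_ ?_ ?_
  · intro x hx
    rw [mem_filter, mem_range, hu]
    exact ⟨ZMod.val_lt x, (hval x).1 hx⟩
  · intro x _ y _ h
    exact ZMod.val_injective m h
  · intro p hp
    rw [mem_filter, mem_range, hu] at hp
    have hpv : (p : ZMod m).val = p := ZMod.val_natCast_of_lt hp.1
    exact ⟨(p : ZMod m), (hval _).2 (by rw [hpv]; exact hp.2), hpv⟩

theorem periodic_cyclicWord [NeZero m] {u : List A} (hu : u.length = m) {d : ℕ} :
    Periodic (cyclicWord u hu) (d : ZMod m) ↔ u.rotate d = u := by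
  constructor
  · intro h
    refine List.ext_getElem? fun p => ?_
    rcases lt_or_ge p m with hp | hp
    · have hpv : (p : ZMod m).val = p := ZMod.val_natCast_of_lt hp
      rw [← hpv, getElem?_rotate_val hu, getElem?_val_eq_some hu, h]
    · rw [List.getElem?_eq_none (by simpa [hu] using hp), List.getElem?_eq_none (hu ▸ hp)]
  · intro h x
    have := getElem?_rotate_val hu d x
    rw [h, getElem?_val_eq_some hu, Option.some_inj] at this
    exact this.symm

/-- By length, `z` is a prefix of `w`; stripping it leaves a word that still commutes with `z`. -/
theorem eq_flatten_replicate_of_commute {z : List A} (q : ℕ) :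
    ∀ {w : List A}, z ++ w = w ++ z → w.length = q * z.length →
      w = (List.replicate q z).flatten := by
  induction q with
  | zero =>
    intro w _ hw
    simpa using hw
  | succ q ih =>
    intro w h hw
    have hle : z.length ≤ w.length := by rw [hw]; exact Nat.le_mul_of_pos_left _ q.succ_pos
    obtain ⟨w', rfl⟩ : z <+: w := List.prefix_of_prefix_length_le (List.prefix_append z w)
      (h ▸ List.prefix_append w z) hle
    rw [List.replicate_succ, List.flatten_cons, ← ih (w := w')]
    · rw [List.append_assoc] at h
      exact List.append_cancel_left h
    · rw [List.length_append, Nat.succ_mul] at hw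
      omega

theorem isPower_iff [NeZero m] {u : List A} (hu : u.length = m) :
    IsPower u ↔ ∃ d, d ∣ m ∧ d < m ∧ Periodic (cyclicWord u hu) (d : ZMod m) := by
  have hm : 0 < m := Nat.pos_of_ne_zero (NeZero.ne m)
  simp_rw [periodic_cyclicWord]
  constructor
  · rintro ⟨z, r, hr, rfl⟩
    have hlen : m = r * z.length := by rw [← hu]; simp
    refine ⟨z.length, ⟨r, by rw [hlen, mul_comm]⟩, ?_, ?_⟩
    · have hz : 0 < z.length := Nat.pos_of_ne_zero fun h => by rw [h] at hlen; omega
      have := Nat.mul_le_mul_right z.length hr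
      omega
    · obtain ⟨r, rfl⟩ : ∃ s, r = s + 1 := ⟨r - 1, by omega⟩
      conv_lhs => rw [List.replicate_succ, List.flatten_cons, List.rotate_append_length_eq]
      rw [List.replicate_succ', List.flatten_append]
      simp
  · rintro ⟨d, ⟨r, hr⟩, hlt, h⟩
    have hr2 : 2 ≤ r := by
      by_contra hr2
      have := Nat.mul_le_mul_left d (show r ≤ 1 by omega)
      omega
    -- Invariance under rotation by `d` says that the prefix of length `d` commutes with the rest.
    rw [List.rotate_eq_drop_append_take (by omega)] at h
    have hz : (u.take d).length = d := by rw [List.length_take]; omega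
    have hw : u.drop d = (List.replicate (r - 1) (u.take d)).flatten := by
      apply eq_flatten_replicate_of_commute
      · rw [h, List.take_append_drop]
      · rw [hz, List.length_drop, hu, hr, Nat.sub_mul, one_mul, mul_comm]
    refine ⟨u.take d, r, hr2, ?_⟩
    obtain ⟨r, rfl⟩ : ∃ s, r = s + 1 := ⟨r - 1, by omega⟩
    rw [List.replicate_succ, List.flatten_cons]
    rw [Nat.add_sub_cancel] at hw
    rw [← hw, List.take_append_drop]

theorem conjugate_iff {u v : List A} :
    Conjugate u v ↔ ∃ i, 1 ≤ i ∧ i < u.length ∧ v = u.rotate i := by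
  constructor
  · rintro ⟨x, y, hx, hy, rfl, rfl⟩
    refine ⟨x.length, List.length_pos_iff.2 hx, ?_, (List.rotate_append_length_eq x y).symm⟩
    have := List.length_pos_iff.2 hy
    rw [List.length_append]
    omega
  · rintro ⟨i, h1, h2, rfl⟩
    refine ⟨u.take i, u.drop i, ?_, ?_, (List.take_append_drop i u).symm,
      List.rotate_eq_drop_append_take h2.le⟩
    · rw [← List.length_pos_iff, List.length_take]; omega
    · rw [← List.length_pos_iff, List.length_drop]; omega

end Words

/-! ### Assembling the formulas -/

theorem powerCount_eq_card (k m : ℕ) [NeZero m] : powerCount k m =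
    Nat.card {f : ZMod m → Fin k // ∃ d, d ∣ m ∧ d < m ∧ Periodic f (d : ZMod m)} :=
  ncard_eq_card_cyclicWord fun _ hu => isPower_iff hu

theorem firstShiftCount_eq_card (k n i : ℕ) [NeZero n] :
    firstShiftCount k n i = Nat.card {f : ZMod n → Fin k // FirstShift i f} := by
  rw [firstShiftCount, ← ncard_eq_card_cyclicWord
    (P := fun u => ham u (u.rotate i) = 2 ∧ ∀ j, 1 ≤ j → j < i → ham u (u.rotate j) ≠ 2)]
  · congr 1
    ext u
    simp only [firstShiftSet, shiftSet, Set.mem_ofPred_eq]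
    grind
  · intro u hu
    simp only [FirstShift, ham_rotate hu]

theorem conjCount_eq_card (k n : ℕ) [NeZero n] :
    conjCount k n = Nat.card {f : ZMod n → Fin k //
      ∃ i : ℕ, 1 ≤ i ∧ i < n ∧ (changes f (i : ZMod n)).card = 2} := by
  refine ncard_eq_card_cyclicWord fun u hu => ?_
  simp_rw [conjugate_iff, hu, ← ham_rotate hu]
  constructor
  · rintro ⟨v, ⟨i, h1, h2, rfl⟩, h⟩
    exact ⟨i, h1, h2, h⟩
  · rintro ⟨i, h1, h2, h⟩
    exact ⟨_, ⟨i, h1, h2, rfl⟩, h⟩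

theorem exists_firstShift {A : Type*} [DecidableEq A] {n : ℕ} [NeZero n] {f : ZMod n → A} :
    (∃ i : ℕ, 1 ≤ i ∧ i < n ∧ (changes f (i : ZMod n)).card = 2) ↔
      ∃ i ∈ Icc 1 (n / 2), FirstShift i f := by
  have hn : 0 < n := Nat.pos_of_ne_zero (NeZero.ne n)
  constructor
  · rintro ⟨i, h1, h2, h⟩
    have hex : ∃ j : ℕ, 1 ≤ j ∧ (changes f (j : ZMod n)).card = 2 := ⟨i, h1, h⟩
    classical
    have hspec := Nat.find_spec hex
    have hle : Nat.find hex ≤ n / 2 := by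
      rcases le_or_gt i (n / 2) with hi | hi
      · exact (Nat.find_min' hex ⟨h1, h⟩).trans hi
      -- The shift by `n - i` is the opposite translation, with equally many jumps.
      · have hneg : (changes f ((n - i : ℕ) : ZMod n)).card = 2 := by
          rw [Nat.cast_sub h2.le, ZMod.natCast_self, zero_sub, card_changes_neg, h]
        have := Nat.find_min' hex ⟨by omega, hneg⟩
        omega
    exact ⟨Nat.find hex, mem_Icc.2 ⟨hspec.1, hle⟩, hspec.2,
      fun j h1 hj hc => Nat.find_min hex hj ⟨h1, hc⟩⟩
  · rintro ⟨i, hi, h⟩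
    rw [mem_Icc] at hi
    exact ⟨i, hi.1, by omega, h.1⟩

theorem conjCount_eq_sum (k n : ℕ) [NeZero n] :
    conjCount k n = ∑ i ∈ Icc 1 (n / 2), firstShiftCount k n i := by
  classical
  simp_rw [conjCount_eq_card, firstShiftCount_eq_card, exists_firstShift, Nat.card_eq_fintype_card,
    Fintype.card_subtype]
  rw [← card_biUnion]
  · congr 1
    ext f
    simp
  · intro i hi j hj hij
    rw [onFun, disjoint_filter]
    rintro f - hfi hfj
    rw [mem_coe, mem_Icc] at hi hj
    rcases lt_or_gt_of_ne hij with h | h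
    · exact hfj.2 i hi.1 h hfi.1
    · exact hfi.2 j hj.1 h hfj.1

theorem powerCount_eq (k m : ℕ) (hm : 1 ≤ m) : (powerCount k m : ℤ) =
    (k : ℤ) ^ m - ∑ d ∈ m.divisors, ArithmeticFunction.moebius d * (k : ℤ) ^ (m / d) := by
  have : NeZero m := ⟨by omega⟩
  have h1 := card_imprimitive_add (A := Fin k) m
  have h2 := primitiveCount_eq (A := Fin k) m hm
  rw [← powerCount_eq_card, Fintype.card_fin] at h1
  rw [Fintype.card_fin] at h2
  rw [← h2]
  have h3 : (powerCount k m : ℤ) + primitiveCount (Fin k) m = (k : ℤ) ^ m := by exact_mod_cast h1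
  linarith

theorem two_mul_firstShiftCount {k n i : ℕ} [NeZero n] (h1 : 1 ≤ i) (h2 : i ≤ n / 2) :
    2 * firstShiftCount k n i +
      2 * (Nat.card {v : ZMod n → Fin k // HasProperPeriod i v} * n * (k - 1)) =
      k ^ n.gcd i * n * (n / n.gcd i - 1) * (k - 1) := by
  have hF : Injective fun a : Fin k => ((a : ℕ) : ℤ) :=
    Nat.cast_injective.comp Fin.val_injective
  simpa [firstShiftCount_eq_card] using two_mul_card_firstShift hF h1 h2

theorem firstShiftCount_cast {k n i : ℕ} [NeZero n] (h1 : 1 ≤ i) (h2 : i ≤ n / 2) :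
    (firstShiftCount k n i : ℚ) =
      if i ∣ n then
        (1 / 2 : ℚ) * (n : ℚ) * ((k : ℚ) - 1) *
          ((k : ℚ) ^ Nat.gcd n i * ((n : ℚ) / (Nat.gcd n i : ℚ) - 1)
            - 2 * (powerCount k i : ℚ))
      else
        (1 / 2 : ℚ) * (k : ℚ) ^ Nat.gcd n i * ((k : ℚ) - 1) * (n : ℚ) *
          ((n : ℚ) / (Nat.gcd n i : ℚ) - 3) := by
  have hn : 0 < n := Nat.pos_of_ne_zero (NeZero.ne n)
  have : NeZero i := ⟨by omega⟩
  have hg0 : 0 < n.gcd i := Nat.gcd_pos_of_pos_left _ hn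
  have hgn : n.gcd i ∣ n := Nat.gcd_dvd_left n i
  have hL : 1 ≤ n / n.gcd i := Nat.div_pos (Nat.le_of_dvd hn hgn) hg0
  have h := two_mul_firstShiftCount (k := k) h1 h2
  have hE : Nat.card {v : ZMod n → Fin k // HasProperPeriod i v} =
      if i ∣ n then powerCount k i else k ^ n.gcd i := by
    split_ifs with hd
    · rw [card_hasProperPeriod_of_dvd hd, powerCount_eq_card]
    · rw [card_hasProperPeriod_of_not_dvd h1 hd, Fintype.card_fin]
  rw [hE] at h
  -- For `k = 0` the natural number `k - 1` truncates to 0 while the rational one is -1; there both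
  -- sides vanish since `n.gcd i > 0` and no words exist.
  rcases Nat.eq_zero_or_pos k with rfl | hk
  · have hp : powerCount 0 i = 0 := by
      rw [powerCount_eq_card]
      have : IsEmpty (ZMod i → Fin 0) := ⟨fun f => (f 0).elim0⟩
      exact Nat.card_of_isEmpty
    have h0 : firstShiftCount 0 n i = 0 := by simpa using h
    simp [h0, hp, hg0.ne']
  · have hQ : (2 : ℚ) * firstShiftCount k n i +
        2 * (((if i ∣ n then powerCount k i else k ^ n.gcd i : ℕ) : ℚ) * n * (k - 1)) =
        (k : ℚ) ^ n.gcd i * n * ((n : ℚ) / (n.gcd i : ℚ) - 1) * (k - 1) := by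
      have h' := congrArg (Nat.cast : ℕ → ℚ) h
      push_cast [Nat.cast_sub hk, Nat.cast_sub hL, Nat.cast_div hgn
        (show ((n.gcd i : ℕ) : ℚ) ≠ 0 by exact_mod_cast hg0.ne')] at h'
      push_cast
      exact h'
    split_ifs with hd
    · rw [if_pos hd] at hQ
      linarith
    · rw [if_neg hd] at hQ
      push_cast at hQ
      linarith

end AlmostCommute

theorem theorem16 (k n : ℕ) (hn : 2 ≤ n) :
    AlmostCommute.conjCount k n
        = ∑ i ∈ Finset.Icc 1 (n / 2), AlmostCommute.firstShiftCount k n i ∧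
    (∀ i ∈ Finset.Icc 1 (n / 2),
      (AlmostCommute.firstShiftCount k n i : ℚ) =
        if i ∣ n then
          (1 / 2 : ℚ) * (n : ℚ) * ((k : ℚ) - 1) *
            ((k : ℚ) ^ Nat.gcd n i * ((n : ℚ) / (Nat.gcd n i : ℚ) - 1)
              - 2 * (AlmostCommute.powerCount k i : ℚ))
        else
          (1 / 2 : ℚ) * (k : ℚ) ^ Nat.gcd n i * ((k : ℚ) - 1) * (n : ℚ) *
            ((n : ℚ) / (Nat.gcd n i : ℚ) - 3)) ∧
    (∀ m : ℕ, 1 ≤ m →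
      (AlmostCommute.powerCount k m : ℤ) =
        (k : ℤ) ^ m - ∑ d ∈ m.divisors, ArithmeticFunction.moebius d * (k : ℤ) ^ (m / d)) := by
  have : NeZero n := ⟨by omega⟩
  refine ⟨AlmostCommute.conjCount_eq_sum k n, fun i hi => ?_, AlmostCommute.powerCount_eq k⟩
  rw [Finset.mem_Icc] at hi
  exact AlmostCommute.firstShiftCount_cast hi.1 hi.2
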